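/- A finite-state transducer (FST) is a tuple $T=\langle Q,q_0,\delta,\lambda\rangle$ with a finite set $Q$ of states, an initial state $q_0\in Q$, a transition function $\delta:Q\times\{0,1\}\to Q$ and an output function $\lambda:Q\times\{0,1\}\to\{0,1\}^*$. It reads an infinite sequence $\sigma\in\{0,1\}^{\mathbb N}$ letter by letter, starting in state $q_0$; reading the letter $a$ in state $q$, it outputs the word $\lambda(q,a)$ and moves to state $\delta(q,a)$. If the concatenation of all these outputs is an infinite sequence $\tau$, then $T$ transduces $\sigma$ to $\tau$. A sequence $\tau\in\{0,1\}^{\mathbb N}$ is a transduct of $\sigma$, written $\sigma\ge\tau$, if some FST transduces $\sigma$ to $\tau$. For $f:\mathbb N\to\mathbb N$, where $\mathbb N=\{0,1,2,\dots\}$, let $\langle f(n)\rangle$ be the infinite sequence $1\,0^{f(0)}\,1\,0^{f(1)}\,1\,0^{f(2)}\cdots$. A sequence $\sigma$ is ultimately periodic if there are integers $n_0\ge 0$ and $r>0$ with $\sigma(n+r)=\sigma(n)$ for all $n\ge n_0$. **Proposition.** Let $p$ be a polynomial of degree $k$ with non-negative integer coefficients, and let $\sigma\in\{0,1\}^{\mathbb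 N}$ be a transduct of $\langle p(n)\rangle$ that is not ultimately periodic. Then $\sigma\ge\langle q(n)\rangle$ for some polynomial $q$ of degree $k$ with non-negative integer coefficients. -/

import Mathlib

/-- The alphabet `𝟐 = {0, 1}`. -/
abbrev Letter : Type := Fin 2

/-- Infinite binary sequences. -/
abbrev InfSeq : Type := ℕ → Letter

/-- The word `σ 0, σ 1, …, σ (n - 1)`. -/
def InfSeq.prefixWord (σ : InfSeq) (n : ℕ) : List Letter := (List.range n).map σ

/-- Ultimate periodicity of a function on `ℕ`. -/
def UltimatelyPeriodic {A : Type*} (f : ℕ → A) : Prop :=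
  ∃ n₀ p : ℕ, 0 < p ∧ ∀ n, n₀ ≤ n → f (n + p) = f n

/-- A complete pure sequential transducer over the alphabet `𝟐` with set of states `Q`. Finiteness
of `Q` is required where transducers are quantified over, in `Transducible`. -/
structure FST (Q : Type) where
  /-- initial state -/
  init : Q
  /-- transition function -/
  step : Q → Letter → Q
  /-- output function -/
  out : Q → Letter → List Letter

namespace FST

/-- The output function extended homomorphically to finite words:
`λ(q, ε) = ε` and `λ(q, a u) = λ(q, a) · λ(δ(q, a), u)`. -/
def outWord {Q : Type} (T : FST Q) : Q → List Letter → List Letter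
  | _, [] => []
  | q, a :: u => T.out q a ++ T.outWord (T.step q a) u

/-- `T(σ) = τ` for infinite sequences `σ` and `τ`: the outputs on the finite prefixes of `σ` are
prefixes of `τ`, and their lengths are unbounded. -/
def Transduces {Q : Type} (T : FST Q) (σ τ : InfSeq) : Prop :=
  (∀ n, T.outWord T.init (σ.prefixWord n) =
      τ.prefixWord (T.outWord T.init (σ.prefixWord n)).length) ∧
    ∀ m, ∃ n, m ≤ (T.outWord T.init (σ.prefixWord n)).length

end FST

/-- `σ ≥ τ`: some finite-state transducer transduces `σ` to `τ`, i.e. `τ` is a transduct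
of `σ`. -/
def Transducible (σ τ : InfSeq) : Prop :=
  ∃ (Q : Type) (_ : Finite Q) (T : FST Q), T.Transduces σ τ

/-- The finite word `1 0^{f 0} 1 0^{f 1} ⋯ 1 0^{f (n - 1)}` made of the first `n` blocks. -/
def blockWord (f : ℕ → ℕ) (n : ℕ) : List Letter :=
  (List.range n).flatMap fun i => 1 :: List.replicate (f i) 0

theorem lt_length_blockWord_succ (f : ℕ → ℕ) (n : ℕ) : n < (blockWord f (n + 1)).length := by
  induction n with
  | zero => simp [blockWord]
  | succ n ih =>
    have h : blockWord f (n + 1 + 1) =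
        blockWord f (n + 1) ++ 1 :: List.replicate (f (n + 1)) 0 := by
      simp [blockWord, List.range_succ]
    rw [h, List.length_append, List.length_cons]
    omega

/-- The infinite sequence `⟨f⟩ = 1 0^{f 0} 1 0^{f 1} 1 0^{f 2} ⋯`. Its first `n + 1` blocks have
more than `n` letters in total, so its letter at position `n` can be read off from them. -/
def blockSeq (f : ℕ → ℕ) : InfSeq := fun n =>
  (blockWord f (n + 1))[n]'(lt_length_blockWord_succ f n)

/-! Let `T` transduce `⟨p⟩` to `σ`. The powers of the action of the letter 0 on states are
ultimately periodic, say with period `d`, and `p n` modulo `d` is periodic in `n`. By pigeonhole,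
for large `n`, the output of `T` on block `n` is `u n` followed by `t n` copies of `v n`, where `u`
and `v` have some period `m` in `n` and `t` grows along residue classes modulo `m` like a polynomial
(`FST.exists_blockOut_eq`, `Polynomial.exists_increment`).

Let `r` be a common multiple of the lengths of the nonempty `v n`, and call a position a break if
its letter differs from the letter `r` places before. Lengthening a factor by copies of `v n`
creates no break, so factors `n` and `n + m` have breaks at the same offsets, and any `m`
consecutive late factors contain the same number `c` of breaks (`Spiral.exists_agree_breakAt`). If
`σ` is not ultimately periodic, breaks never die out and `c > 0`. A transducer can detect breaks
with a buffer of `r` letters and keep every `c`-th one; the gaps between those kept are the total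
lengths of `m` consecutive factors (`Spiral.exists_transducible`). These lengths form a polynomial
of the degree of `p`: natural coefficients cannot cancel, and some `v n` is nonempty. -/

/-! ### Composition of transducers -/

theorem InfSeq.prefixWord_succ (σ : InfSeq) (n : ℕ) :
    σ.prefixWord (n + 1) = σ.prefixWord n ++ [σ n] := by
  simp [InfSeq.prefixWord, List.range_succ]

@[simp] theorem InfSeq.length_prefixWord (σ : InfSeq) (n : ℕ) :
    (σ.prefixWord n).length = n := by
  simp [InfSeq.prefixWord]

theorem InfSeq.prefixWord_add (σ : InfSeq) (n k : ℕ) :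
    σ.prefixWord (n + k) = σ.prefixWord n ++ (List.range k).map fun i => σ (n + i) := by
  induction k with
  | zero => simp
  | succ k ih =>
    rw [← add_assoc, InfSeq.prefixWord_succ, ih, List.range_succ]
    simp

namespace FST

variable {Q Q₁ Q₂ : Type}

/-- The state reached from `q` by reading a finite word. -/
def run (T : FST Q) (q : Q) (w : List Letter) : Q := w.foldl T.step q

@[simp] theorem run_nil (T : FST Q) (q : Q) : T.run q [] = q := rfl

@[simp] theorem run_cons (T : FST Q) (q : Q) (a : Letter) (w : List Letter) :
    T.run q (a :: w) = T.run (T.step q a) w := rfl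

theorem run_append (T : FST Q) (q : Q) (w w' : List Letter) :
    T.run q (w ++ w') = T.run (T.run q w) w' := by
  simp [run]

theorem outWord_append (T : FST Q) (q : Q) (w w' : List Letter) :
    T.outWord q (w ++ w') = T.outWord q w ++ T.outWord (T.run q w) w' := by
  induction w generalizing q with
  | nil => simp [outWord]
  | cons a w ih => simp [outWord, ih]

/-- The sequential composition of two transducers. -/
def comp (T₁ : FST Q₁) (T₂ : FST Q₂) : FST (Q₁ × Q₂) where
  init := (T₁.init, T₂.init)
  step q a := (T₁.step q.1 a, T₂.run q.2 (T₁.out q.1 a))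
  out q a := T₂.outWord q.2 (T₁.out q.1 a)

theorem outWord_comp (T₁ : FST Q₁) (T₂ : FST Q₂) (q : Q₁ × Q₂) (w : List Letter) :
    (T₁.comp T₂).outWord q w = T₂.outWord q.2 (T₁.outWord q.1 w) := by
  induction w generalizing q with
  | nil => simp [outWord]
  | cons a w ih =>
    simp only [outWord, outWord_append]
    rw [ih]
    rfl

theorem length_outWord_prefixWord_mono (T : FST Q) (q : Q) (σ : InfSeq) :
    Monotone fun n => (T.outWord q (σ.prefixWord n)).length := by
  refine monotone_nat_of_le_succ fun n => ?_
  simp [InfSeq.prefixWord_succ, outWord_append]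

end FST

theorem Transducible.trans {σ τ ρ : InfSeq} (h₁ : Transducible σ τ) (h₂ : Transducible τ ρ) :
    Transducible σ ρ := by
  obtain ⟨Q₁, hQ₁, T₁, hp₁, hu₁⟩ := h₁
  obtain ⟨Q₂, hQ₂, T₂, hp₂, hu₂⟩ := h₂
  refine ⟨Q₁ × Q₂, inferInstance, T₁.comp T₂, fun n => ?_, fun m => ?_⟩
  · rw [FST.outWord_comp]
    change T₂.outWord T₂.init (T₁.outWord T₁.init _) =
      ρ.prefixWord (T₂.outWord T₂.init (T₁.outWord T₁.init _)).length
    rw [hp₁ n]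
    exact hp₂ _
  · obtain ⟨k, hk⟩ := hu₂ m
    obtain ⟨n, hn⟩ := hu₁ k
    refine ⟨n, hk.trans ?_⟩
    rw [FST.outWord_comp]
    change _ ≤ (T₂.outWord T₂.init (T₁.outWord T₁.init _)).length
    rw [hp₁ n]
    exact T₂.length_outWord_prefixWord_mono _ τ hn

/-! ### Elementary transductions -/

/-- The output sequence of a letter-to-letter machine is a transduct of its input. -/
theorem transducible_of_letterwise {Q : Type} [Finite Q] (step : Q → Letter → Q)
    (out : Q → Letter → Letter) (σ : InfSeq) (s : ℕ → Q)
    (hs : ∀ n, s (n + 1) = step (s n) (σ n)) :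
    Transducible σ fun n => out (s n) (σ n) := by
  let T : FST Q := ⟨s 0, step, fun q a => [out q a]⟩
  have hrun : ∀ n, T.run T.init (σ.prefixWord n) = s n := by
    intro n
    induction n with
    | zero => rfl
    | succ n ih => rw [InfSeq.prefixWord_succ, FST.run_append, ih, hs]; rfl
  have hout : ∀ n, T.outWord T.init (σ.prefixWord n) =
      InfSeq.prefixWord (fun n => out (s n) (σ n)) n := by
    intro n
    induction n with
    | zero => rfl
    | succ n ih =>
      rw [InfSeq.prefixWord_succ, FST.outWord_append, ih, hrun, InfSeq.prefixWord_succ]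
      rfl
  exact ⟨Q, inferInstance, T, fun n => by simp [hout], fun m => ⟨m, by simp [hout]⟩⟩

theorem transducible_tail (σ : InfSeq) : Transducible σ fun n => σ (n + 1) := by
  let T : FST Bool := ⟨false, fun _ _ => true, fun q a => if q then [a] else []⟩
  have hrun : ∀ n, T.run T.init (σ.prefixWord (n + 1)) = true := by
    intro n
    rw [InfSeq.prefixWord_succ, FST.run_append]
    rfl
  have hout : ∀ n, T.outWord T.init (σ.prefixWord (n + 1)) =
      InfSeq.prefixWord (fun n => σ (n + 1)) n := by
    intro n
    induction n with
    | zero => simp [InfSeq.prefixWord, FST.outWord, T]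
    | succ n ih =>
      rw [InfSeq.prefixWord_succ, FST.outWord_append, ih, hrun, InfSeq.prefixWord_succ]
      simp [FST.outWord, T]
  refine ⟨Bool, inferInstance, T, fun n => ?_, fun m => ⟨m + 1, by simp [hout]⟩⟩
  cases n with
  | zero => rfl
  | succ n => simp [hout]

theorem transducible_refl (σ : InfSeq) : Transducible σ σ :=
  transducible_of_letterwise (Q := Unit) (fun _ _ => ()) (fun _ a => a) σ (fun _ => ())
    fun _ => rfl

theorem transducible_drop (σ : InfSeq) (k : ℕ) : Transducible σ fun n => σ (n + k) := by
  induction k with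
  | zero => exact transducible_refl σ
  | succ k ih =>
    have h := ih.trans (transducible_tail _)
    simpa [add_assoc, add_comm, add_left_comm] using h

/-- The indicator sequence of the positions at which `σ` differs from its translate by `r`. -/
def breakSeq (σ : InfSeq) (r : ℕ) : InfSeq := fun n => if σ n = σ (n + r) then 0 else 1

/-- A shift register of `r` cells, initially zero, compares each letter with the one `r` places
before; the first `r` outputs, which involve the padding, are dropped. The register needs a cell,
hence the separate case `r = 0`. -/
theorem transducible_breakSeq (σ : InfSeq) (r : ℕ) : Transducible σ (breakSeq σ r) := by
  rcases Nat.eq_zero_or_pos r with rfl | hr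
  · have h := transducible_of_letterwise (Q := Unit) (fun _ _ => ()) (fun _ _ => 0) σ (fun _ => ())
      fun _ => rfl
    convert h using 2
    simp [breakSeq]
  let pad : InfSeq := fun k => if k < r then 0 else σ (k - r)
  have h := transducible_of_letterwise (Q := Fin r → Letter)
    (fun s a j => if h : j.1 + 1 < r then s ⟨j.1 + 1, h⟩ else a)
    (fun s a => if s ⟨0, hr⟩ = a then 0 else 1) σ (fun n j => pad (n + j.1)) (by
      intro n
      funext j
      split_ifs with h
      · congr 1; simp only; omega
      · have : n + 1 + j.1 = n + r := by omega
        simp [this, pad])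
  have h' := h.trans (transducible_drop _ r)
  convert h' using 1
  funext n
  simp [breakSeq, pad]

/-- The sequence that keeps of the ones of `b` those preceded by a multiple of `c` ones. -/
theorem transducible_every (b : InfSeq) (c : ℕ) (hc : 0 < c) :
    Transducible b fun n =>
      if b n = 1 ∧ c ∣ ∑ y ∈ Finset.range n, (b y).val then 1 else 0 := by
  have : NeZero c := ⟨hc.ne'⟩
  have h := transducible_of_letterwise (Q := ZMod c) (fun s a => s + (a.val : ZMod c))
    (fun s a => if a = 1 ∧ s = 0 then 1 else 0) b
    (fun n => ((∑ y ∈ Finset.range n, (b y).val : ℕ) : ZMod c)) (by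
      intro n
      rw [Finset.sum_range_succ, Nat.cast_add])
  simpa only [ZMod.natCast_eq_zero_iff] using h

/-! ### Recognising block sequences -/

theorem blockWord_succ (f : ℕ → ℕ) (n : ℕ) :
    blockWord f (n + 1) = blockWord f n ++ 1 :: List.replicate (f n) 0 := by
  simp [blockWord, List.range_succ]

/-- A sequence whose ones sit exactly at the starts of the blocks is `⟨f⟩`. -/
theorem eq_blockSeq (f : ℕ → ℕ) (τ : InfSeq) (Y : ℕ → ℕ) (h0 : Y 0 = 0)
    (hY : ∀ i, Y (i + 1) = Y i + f i + 1) (h1 : ∀ i, τ (Y i) = 1)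
    (hz : ∀ i x, Y i < x → x < Y (i + 1) → τ x = 0) : τ = blockSeq f := by
  have key : ∀ i, blockWord f i = τ.prefixWord (Y i) := by
    intro i
    induction i with
    | zero => simp [h0, blockWord, InfSeq.prefixWord]
    | succ i ih =>
      rw [blockWord_succ, ih, hY, add_assoc, add_comm (f i) 1, ← add_assoc,
        InfSeq.prefixWord_add τ (Y i + 1), InfSeq.prefixWord_succ, h1]
      simp only [List.append_assoc, List.singleton_append]
      congr 2
      refine List.ext_getElem (by simp) fun x hx _ => ?_
      simp only [List.length_replicate] at hx
      simp only [List.getElem_replicate, List.getElem_map, List.getElem_range]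
      exact (hz i _ (by omega) (by rw [hY]; omega)).symm
  funext n
  simp only [blockSeq, key, InfSeq.prefixWord, List.getElem_map, List.getElem_range]

theorem blockWord_eq_prefixWord (f : ℕ → ℕ) (n : ℕ) :
    blockWord f n = (blockSeq f).prefixWord (blockWord f n).length := by
  have hpre : ∀ i j, i ≤ j → blockWord f i <+: blockWord f j := by
    intro i j hij
    induction j, hij using Nat.le_induction with
    | base => exact List.prefix_rfl
    | succ j _ ih => exact ih.trans (by rw [blockWord_succ]; exact List.prefix_append _ _)
  refine List.ext_getElem (by simp) fun x hx _ => ?_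
  simp only [InfSeq.prefixWord, List.getElem_map, List.getElem_range, blockSeq]
  have hx' := lt_length_blockWord_succ f x
  rcases le_total n (x + 1) with h | h
  · exact (hpre _ _ h).getElem hx
  · exact ((hpre _ _ h).getElem hx').symm

/-- Sampling a sequence of zeros and ones whose number of ones between consecutive marked ones
is constant yields the blocks between the marks. -/
theorem transducible_blockSeq_of_marks (b : InfSeq) (X F : ℕ → ℕ) (c : ℕ) (hc : 0 < c)
    (hX : ∀ i, X (i + 1) = X i + F i + 1) (hb : ∀ i, b (X i) = 1)
    (hcount : ∀ i, ∑ y ∈ Finset.range (X (i + 1)), (b y).val =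
      ∑ y ∈ Finset.range (X i), (b y).val + c) :
    Transducible b (blockSeq F) := by
  have h := (transducible_drop b (X 0)).trans (transducible_every _ c hc)
  have hle : ∀ i, X 0 ≤ X i := fun i => by
    induction i with
    | zero => exact le_rfl
    | succ i ih => rw [hX]; omega
  set N : ℕ → ℕ := fun z => ∑ y ∈ Finset.range z, (b y).val with hN
  have hmono : Monotone N := monotone_nat_of_le_succ fun n => by
    simp only [hN, Finset.sum_range_succ]; omega
  have hNi : ∀ i, N (X i) = N (X 0) + c * i := fun i => by
    induction i with
    | zero => simp
    | succ i ih => have := hcount i; simp only [hN] at ih ⊢; rw [this, ih]; ring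
  have hsucc : ∀ z, b z = 1 → N (z + 1) = N z + 1 := fun z hz => by
    simp [hN, Finset.sum_range_succ, hz]
  have hsum : ∀ y, N (X 0 + y) =
      N (X 0) + ∑ k ∈ Finset.range y, (b (k + X 0)).val := fun y => by
    simp only [hN, Finset.sum_range_add]
    simp only [add_comm]
  convert h using 1
  symm
  refine eq_blockSeq F _ (fun i => X i - X 0) (by simp) (fun i => ?_) (fun i => ?_) ?_
  · have := hX i; have := hle i; omega
  · have h1 := hsum (X i - X 0)
    rw [Nat.add_sub_cancel' (hle i), hNi] at h1
    have h2 : ∑ k ∈ Finset.range (X i - X 0), (b (k + X 0)).val = c * i := by omega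
    simp only [h2, Nat.sub_add_cancel (hle i), hb, dvd_mul_right, and_self, if_true]
  · intro i x hx1 hx2
    refine if_neg ?_
    rintro ⟨hbx, hdvd⟩
    have hle' := hle i
    have h1 := hsum x
    have h2 := hsucc _ hbx
    have h3 : N (x + X 0 + 1) ≤ N (X (i + 1)) := hmono (by omega)
    have h4 : N (X i + 1) ≤ N (x + X 0) := hmono (by omega)
    have h5 := hsucc _ (hb i)
    have h6 := hNi i
    have h7 := hNi (i + 1)
    rw [add_comm x] at h2 h3 h4
    obtain ⟨e, he⟩ := hdvd
    rw [he] at h1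
    -- A further kept one strictly between marks `i` and `i + 1` would have a multiple of `c`
    -- strictly between `c * i` and `c * (i + 1)` as its count.
    have h8 : c * i < c * e := by omega
    have h9 : c * e < c * (i + 1) := by omega
    have := lt_of_mul_lt_mul_left h8 (Nat.zero_le _)
    have := lt_of_mul_lt_mul_left h9 (Nat.zero_le _)
    omega

/-! ### Spiral decompositions -/

/-- Decomposition of an infinite sequence into consecutive factors of lengths `len n` starting at
positions `S n`, in which, for `n ≥ n₀`, the factor `n + m` either equals the factor `n` or
prolongs it by repeating a period that divides `r`. -/
structure Spiral (σ : InfSeq) (S len : ℕ → ℕ) (m r n₀ : ℕ) : Prop where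
  pos_m : 0 < m
  pos_r : 0 < r
  start_succ : ∀ n, S (n + 1) = S n + len n
  unbounded : ∀ x, ∃ n, x ≤ S n
  agree : ∀ n, n₀ ≤ n → ∀ x, x < len n → σ (S n + x) = σ (S (n + m) + x)
  growth : ∀ n, n₀ ≤ n → len (n + m) = len n ∨
    ∃ d e U, d ∣ r ∧ len (n + m) = len n + d * e ∧ U + r ≤ len n ∧
      ∀ k, k = n ∨ k = n + m → ∀ x, U ≤ x → x + d < len k → σ (S k + x) = σ (S k + x + d)

namespace Spiral

variable {σ : InfSeq} {S len : ℕ → ℕ} {m r n₀ : ℕ}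

theorem mono (h : Spiral σ S len m r n₀) : Monotone S :=
  monotone_nat_of_le_succ fun n => by rw [h.start_succ]; omega

theorem exists_block (h : Spiral σ S len m r n₀) (n x : ℕ) (hx : S n ≤ x) :
    ∃ k y, n ≤ k ∧ y < len k ∧ x = S k + y := by
  obtain ⟨N, hN⟩ := h.unbounded (x + 1)
  have hex : ∃ N, x < S N := ⟨N, hN⟩
  have hn : n < Nat.find hex := by
    by_contra hcon
    have := h.mono (not_lt.mp hcon)
    have := Nat.find_spec hex
    omega
  obtain ⟨k, hk⟩ : ∃ k, Nat.find hex = k + 1 := ⟨Nat.find hex - 1, by omega⟩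
  have h1 := Nat.find_spec hex
  have h2 := Nat.find_min hex (m := k) (by omega)
  rw [hk, h.start_succ] at h1
  exact ⟨k, x - S k, by omega, by omega, by omega⟩

theorem periodic_iterate {g : ℕ → Letter} {d U L : ℕ}
    (hg : ∀ x, U ≤ x → x + d < L → g x = g (x + d)) (e x : ℕ) (hx : U ≤ x)
    (hL : x + d * e < L) : g x = g (x + d * e) := by
  induction e with
  | zero => simp
  | succ e ih =>
    rw [mul_add, mul_one] at hL
    rw [ih (by omega), hg (x + d * e) (by omega) (by omega), mul_add, mul_one, add_assoc]

/-- Far enough to the right, the `r` letters preceding the factors `n` and `n + m` agree. -/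
theorem agree_left (h : Spiral σ S len m r n₀) {n : ℕ} (hn : n₀ ≤ n) (j : ℕ) :
    ∀ e, 1 ≤ e → e ≤ r → e ≤ S (n + j) - S n →
      σ (S (n + j) - e) = σ (S (n + j + m) - e) := by
  induction j with
  | zero => intro e he _ h'; simp at h'; omega
  | succ j ih =>
    intro e he her heS
    set k := n + j with hk
    have hmono : S n ≤ S k := h.mono (by omega)
    have e1 := h.start_succ k
    have e2 := h.start_succ (k + m)
    have hk1 : n + (j + 1) = k + 1 := by omega
    have hk2 : n + (j + 1) + m = k + m + 1 := by omega
    rw [hk1] at heS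
    rw [hk1, show k + 1 + m = k + m + 1 by omega, e1, e2]
    rcases h.growth k (by omega) with heq | ⟨d, f, U, hd, hlen, hU, hper⟩
    · rw [heq]
      rcases le_or_gt e (len k) with hle | hgt
      · have := h.agree k (by omega) (len k - e) (by omega)
        rw [Nat.add_sub_assoc hle, Nat.add_sub_assoc hle, this]
      -- The position lies left of factor `k`, which has the same length as factor `k + m`.
      · have := ih (e - len k) (by omega) (by omega) (by omega)
        rw [show S k + len k - e = S k - (e - len k) by omega, this]
        congr 1
        have : S k ≤ S (k + m) := h.mono (by omega)
        omega
    -- The prolongation consists of whole periods and the last `r` letters of factor `k` lie in its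
    -- periodic part, so both factors end in the same `r` letters.
    · have h1 := h.agree k (by omega) (len k - e) (by omega)
      have h2 := periodic_iterate (g := fun x => σ (S (k + m) + x)) (d := d) (U := U)
        (L := len (k + m)) (fun x hx hx' => by
          rw [← add_assoc]; exact hper (k + m) (Or.inr rfl) x hx hx') f (len k - e)
          (by omega) (by omega)
      beta_reduce at h2
      rw [show S k + len k - e = S k + (len k - e) by omega, h1, h2, hlen]
      congr 1
      omega

end Spiral

/-! ### Breaks of a spiral sequence -/

/-- The indicator of the positions `z ≥ r` at which the letter of `σ` differs from the letter `r`
positions before. -/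
def breakAt (σ : InfSeq) (r : ℕ) (z : ℕ) : ℕ := if z < r then 0 else (breakSeq σ r (z - r)).val

theorem breakAt_eq (σ : InfSeq) {r z : ℕ} (hz : r ≤ z) :
    breakAt σ r z = if σ (z - r) = σ z then 0 else 1 := by
  rw [breakAt, if_neg (by omega), breakSeq, Nat.sub_add_cancel hz]
  split_ifs <;> rfl

namespace Spiral

variable {σ : InfSeq} {S len : ℕ → ℕ} {m r n₀ : ℕ}

theorem sum_start_add (f : ℕ → ℕ) (s l : ℕ) : ∑ y ∈ Finset.range (s + l), f y =
    ∑ y ∈ Finset.range s, f y + ∑ x ∈ Finset.range l, f (s + x) :=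
  Finset.sum_range_add _ _ _

/-- Both letters compared at a break recur in factor `n + m`: by `agree` inside the factor, by
`agree_left` across its left end. The prolongation has a period dividing `r`, so it contributes no
break. -/
theorem exists_agree_breakAt (h : Spiral σ S len m r n₀) : ∃ n₁, n₀ ≤ n₁ ∧ ∀ n, n₁ ≤ n →
    r ≤ S n ∧ (∀ x, x < len n → breakAt σ r (S n + x) = breakAt σ r (S (n + m) + x)) ∧
    len n ≤ len (n + m) ∧
    ∀ x, len n ≤ x → x < len (n + m) → breakAt σ r (S (n + m) + x) = 0 := by
  obtain ⟨N, hN⟩ := h.unbounded (S n₀ + r)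
  refine ⟨max n₀ N, le_max_left _ _, fun n hn => ?_⟩
  have hSn : S n₀ + r ≤ S n := hN.trans (h.mono ((le_max_right _ _).trans hn))
  have hn₀ : n₀ ≤ n := (le_max_left _ _).trans hn
  have hSm : S n ≤ S (n + m) := h.mono (by omega)
  refine ⟨by omega, fun x hx => ?_, ?_, fun x hx hx' => ?_⟩
  · rw [breakAt_eq _ (by omega), breakAt_eq _ (by omega), h.agree n hn₀ x hx]
    congr 2
    rcases le_or_gt r x with hrx | hrx
    · rw [Nat.add_sub_assoc hrx, Nat.add_sub_assoc hrx, h.agree n hn₀ _ (by omega)]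
    · have := h.agree_left le_rfl (n - n₀) (r - x) (by omega) (by omega)
      rw [show n₀ + (n - n₀) = n by omega] at this
      rw [show S n + x - r = S n - (r - x) by omega, this (by omega)]
      congr 1
      omega
  · rcases h.growth n hn₀ with heq | ⟨d, f, U, hd, hlen, hU, hper⟩ <;> omega
  · rcases h.growth n hn₀ with heq | ⟨d, f, U, hd, hlen, hU, hper⟩
    · omega
    · obtain ⟨g, hg⟩ := hd
      have h2 := periodic_iterate (g := fun x => σ (S (n + m) + x)) (d := d) (U := U)
        (L := len (n + m)) (fun x hx hx' => by
          rw [← add_assoc]; exact hper (n + m) (Or.inr rfl) x hx hx') g (x - r)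
          (by omega) (by omega)
      beta_reduce at h2
      rw [breakAt_eq _ (by omega), if_pos]
      rw [show S (n + m) + x - r = S (n + m) + (x - r) by omega, h2]
      congr 1
      omega

/-- The marks are the breaks at one fixed offset in the factors `n + m * i`, so their gaps equal
those between the starts of these factors. The conclusion `0 < len n` makes the gaps positive. -/
theorem exists_transducible (h : Spiral σ S len m r n₀) (hσ : ¬ UltimatelyPeriodic σ) :
    ∃ n, n₀ ≤ n ∧ 0 < len n ∧ ∀ F : ℕ → ℕ,
      (∀ i, S (n + m * (i + 1)) = S (n + m * i) + F i + 1) → Transducible σ (blockSeq F) := by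
  obtain ⟨n₁, hn₁, hbr⟩ := h.exists_agree_breakAt
  set N : ℕ → ℕ := fun z => ∑ y ∈ Finset.range z, breakAt σ r y with hN
  have hNS : ∀ n, N (S (n + 1)) =
      N (S n) + ∑ x ∈ Finset.range (len n), breakAt σ r (S n + x) := fun n => by
    rw [h.start_succ]; exact sum_start_add _ _ _
  have hmono : Monotone N := monotone_nat_of_le_succ fun n => by
    simp only [hN, Finset.sum_range_succ]; omega
  have hstep : ∀ n, n₁ ≤ n → ∑ x ∈ Finset.range (len (n + m)), breakAt σ r (S (n + m) + x) =
      ∑ x ∈ Finset.range (len n), breakAt σ r (S n + x) := fun n hn => by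
    obtain ⟨-, h1, h2, h3⟩ := hbr n hn
    obtain ⟨e, he⟩ := Nat.exists_eq_add_of_le h2
    rw [he, Finset.sum_range_add, Finset.sum_eq_zero (s := Finset.range e), add_zero]
    · exact Finset.sum_congr rfl fun x hx => (h1 x (Finset.mem_range.mp hx)).symm
    · intro x hx
      have := Finset.mem_range.mp hx
      exact h3 _ (by omega) (by omega)
  obtain ⟨c, hc⟩ : ∃ c, N (S (n₁ + m)) = N (S n₁) + c :=
    Nat.exists_eq_add_of_le (hmono (h.mono (by omega)))
  have hcount : ∀ n, n₁ ≤ n → N (S (n + m)) = N (S n) + c := fun n hn => by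
    induction n, hn using Nat.le_induction with
    | base => exact hc
    | succ n hn ih =>
      rw [show n + 1 + m = n + m + 1 by omega, hNS, hNS, ih, hstep n hn]
      omega
  -- Without a late break, `r` would be an ultimate period of `σ`.
  obtain ⟨z, hz, hzb⟩ : ∃ z, S n₁ ≤ z ∧ breakAt σ r z = 1 := by
    by_contra hcon
    push Not at hcon
    refine hσ ⟨S n₁, r, h.pos_r, fun z hz => ?_⟩
    have h1 := hcon (z + r) (by omega)
    rw [breakAt_eq _ (by omega), Nat.add_sub_cancel] at h1
    by_contra h2
    exact h1 (if_neg fun h3 => h2 h3.symm)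
  obtain ⟨n, y, hn, hy, rfl⟩ := h.exists_block n₁ z hz
  have hzN : N (S n + y + 1) = N (S n + y) + 1 := by
    simp only [hN, Finset.sum_range_succ, hzb]
  have hall : ∀ i, y < len (n + m * i) ∧ breakAt σ r (S (n + m * i) + y) = 1 ∧
      ∑ x ∈ Finset.range y, breakAt σ r (S (n + m * i) + x) =
        ∑ x ∈ Finset.range y, breakAt σ r (S n + x) := fun i => by
    induction i with
    | zero => exact ⟨hy, hzb, rfl⟩
    | succ i ih =>
      obtain ⟨-, h1, h2, -⟩ := hbr (n + m * i) (by omega)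
      rw [mul_add, mul_one, ← add_assoc]
      refine ⟨by omega, by rw [← h1 y ih.1, ih.2.1], ?_⟩
      rw [← ih.2.2]
      refine Finset.sum_congr rfl fun x hx => (h1 x ?_).symm
      have := Finset.mem_range.mp hx
      omega
  have hcpos : 0 < c := by
    by_contra hcon
    have h1 : ∀ j, N (S (n + m * j)) = N (S n) := fun j => by
      induction j with
      | zero => simp
      | succ j ih => rw [mul_add, mul_one, ← add_assoc, hcount _ (by omega), ih]; omega
    have h2 : N (S n) ≤ N (S n + y) := hmono (by omega)
    have h3 : N (S n + y + 1) ≤ N (S (n + 1)) := hmono (by rw [h.start_succ]; omega)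
    have h4 : N (S (n + 1)) ≤ N (S (n + m * 1)) := hmono (h.mono (by have := h.pos_m; omega))
    have h5 := h1 1
    omega
  refine ⟨n, by omega, by omega, fun F hF => ?_⟩
  refine (transducible_breakSeq σ r).trans ?_
  have hrS : ∀ i, r ≤ S (n + m * i) := fun i => (hbr (n + m * i) (by omega)).1
  -- `breakSeq` records a break at the earlier of the two compared positions, `breakAt` at the later
  -- one; hence the shift by `r`.
  have hcnt : ∀ z, r ≤ z → ∑ x ∈ Finset.range (z - r), (breakSeq σ r x).val = N z := by
    intro z hz
    obtain ⟨e, rfl⟩ := Nat.exists_eq_add_of_le hz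
    simp only [hN]
    rw [Finset.sum_range_add, Finset.sum_eq_zero (s := Finset.range r), zero_add,
      Nat.add_sub_cancel_left]
    · refine Finset.sum_congr rfl fun x _ => ?_
      rw [breakAt, if_neg (by omega), Nat.add_sub_cancel_left]
    · intro x hx
      exact if_pos (Finset.mem_range.mp hx)
  refine transducible_blockSeq_of_marks _ (fun i => S (n + m * i) + y - r) F c hcpos
    (fun i => ?_) (fun i => ?_) fun i => ?_
  · have := hF i; have := hrS i; omega
  · have h1 := (hall i).2.1
    have := hrS i
    rw [breakAt, if_neg (by omega)] at h1
    exact Fin.ext h1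
  · have := hrS i
    have := hrS (i + 1)
    rw [hcnt _ (by omega), hcnt _ (by omega)]
    simp only [hN]
    rw [sum_start_add, sum_start_add, (hall i).2.2, (hall (i + 1)).2.2, mul_add, mul_one,
      ← add_assoc]
    have := hcount (n + m * i) (by omega)
    simp only [hN] at this
    omega

end Spiral

/-! ### Increments of polynomials and periodicity of iterates -/

open Polynomial in
/-- Along a residue class modulo `d * e`, the increments of `p` are `d` times a polynomial of the
same degree with natural coefficients. -/
theorem Polynomial.exists_increment (p : Polynomial ℕ) (hp : 0 < p.natDegree) {d e : ℕ}
    (hd : 0 < d) (he : 0 < e) (n : ℕ) : ∃ P : Polynomial ℕ, P.natDegree = p.natDegree ∧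
      ∀ i, p.eval (n + d * e * i) = p.eval n + d * P.eval i := by
  set s := p.comp (X + C n) with hs
  -- Removing the constant term of `p (X + n)` through `divX` avoids subtraction in `ℕ`.
  set P := s.divX.comp (C (d * e) * X) * (C e * X) with hP
  have hdeg : s.natDegree = p.natDegree := by
    rw [hs, natDegree_comp, natDegree_X_add_C, mul_one]
  have hcomp : s.comp (C (d * e) * X) = C d * P + C (s.coeff 0) := by
    conv_lhs => rw [← divX_mul_X_add s]
    rw [add_comp, mul_comp, X_comp, C_comp, hP, C_mul]
    ring
  have heval : ∀ i, p.eval (n + d * e * i) = d * P.eval i + s.coeff 0 := fun i => by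
    have h := congrArg (eval i) hcomp
    rw [eval_comp, hs, eval_comp] at h
    simp only [eval_add, eval_mul, eval_C, eval_X] at h
    rw [add_comm n]
    exact h
  refine ⟨P, ?_, fun i => ?_⟩
  · have h := congrArg natDegree hcomp
    rw [natDegree_comp, natDegree_C_mul_X _ (Nat.mul_pos hd he).ne', mul_one, hdeg,
      natDegree_add_C, natDegree_C_mul_of_mul_ne_zero] at h
    · exact h.symm
    · intro h0
      have hP0 : P = 0 := by
        rcases Nat.mul_eq_zero.mp h0 with h0 | h0
        · omega
        · exact leadingCoeff_eq_zero.mp h0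
      rw [hP0] at h
      simp at h
      omega
  · have h0 := heval 0
    have hP0 : P.eval 0 = 0 := by simp [hP]
    rw [hP0] at h0
    simp only [mul_zero, add_zero, zero_add] at h0
    rw [heval, h0, add_comm]

/-- This makes late blocks longer than any prescribed threshold. -/
theorem Polynomial.le_eval_of_natDegree_pos (p : Polynomial ℕ) (hp : 0 < p.natDegree) (n : ℕ) :
    n ≤ p.eval n := by
  rw [Polynomial.eval_eq_sum_range]
  have h1 : p.coeff p.natDegree * n ^ p.natDegree ≤
      ∑ i ∈ Finset.range (p.natDegree + 1), p.coeff i * n ^ i :=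
    Finset.single_le_sum (f := fun i => p.coeff i * n ^ i) (fun _ _ => Nat.zero_le _)
      (Finset.mem_range.mpr (Nat.lt_succ_self _))
  refine le_trans ?_ h1
  have h2 : 0 < p.coeff p.natDegree := Nat.pos_of_ne_zero fun h => by
    have := Polynomial.leadingCoeff_eq_zero.mp h
    rw [this] at hp
    simp at hp
  calc n ≤ n ^ p.natDegree := Nat.le_self_pow hp.ne' n
    _ ≤ _ := Nat.le_mul_of_pos_left _ h2

/-- Two of the iterates coincide because `Q → Q` is finite. -/
theorem Function.exists_iterate_add_eq {Q : Type} [Finite Q] (z : Q → Q) :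
    ∃ a d, 0 < d ∧ ∀ n, a ≤ n → ∀ e, z^[n + d * e] = z^[n] := by
  obtain ⟨i, j, hne, hij⟩ := Finite.exists_ne_map_eq_of_infinite fun n : ℕ => z^[n]
  wlog hlt : i < j generalizing i j
  · exact this j i hne.symm hij.symm (by omega)
  refine ⟨i, j - i, by omega, fun n hn e => ?_⟩
  induction e with
  | zero => simp
  | succ e ih =>
    rw [← ih, mul_add, mul_one,
      show n + ((j - i) * e + (j - i)) = (n - i + (j - i) * e) + j by omega,
      Function.iterate_add, ← hij, ← Function.iterate_add]
    congr 1
    omega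

/-! ### Output of a transducer on a block sequence -/

namespace FST

variable {Q : Type} (T : FST Q)

theorem run_zeros (q : Q) (n : ℕ) :
    T.run q (List.replicate n 0) = (fun s => T.step s 0)^[n] q := by
  induction n generalizing q with
  | zero => rfl
  | succ n ih => rw [List.replicate_succ, run_cons, ih, Function.iterate_succ_apply]

/-- The state of the transducer in front of block `n` of its input `⟨f⟩`. -/
def blockState (f : ℕ → ℕ) (n : ℕ) : Q := T.run T.init (blockWord f n)

/-- The output of the transducer on block `n` of its input `⟨f⟩`. -/
def blockOut (f : ℕ → ℕ) (n : ℕ) : List Letter :=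
  T.outWord (T.blockState f n) (1 :: List.replicate (f n) 0)

/-- The length of the output of the transducer on the first `n` blocks of `⟨f⟩`. -/
def blockStart (f : ℕ → ℕ) (n : ℕ) : ℕ := (T.outWord T.init (blockWord f n)).length

theorem blockState_succ (f : ℕ → ℕ) (n : ℕ) : T.blockState f (n + 1) =
    (fun s => T.step s 0)^[f n] (T.step (T.blockState f n) 1) := by
  rw [blockState, blockWord_succ, run_append, run_cons, run_zeros]
  rfl

theorem outWord_blockWord_succ (f : ℕ → ℕ) (n : ℕ) : T.outWord T.init (blockWord f (n + 1)) =
    T.outWord T.init (blockWord f n) ++ T.blockOut f n := by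
  rw [blockWord_succ, outWord_append]
  rfl

theorem blockStart_succ (f : ℕ → ℕ) (n : ℕ) :
    T.blockStart f (n + 1) = T.blockStart f n + (T.blockOut f n).length := by
  simp only [blockStart, outWord_blockWord_succ, List.length_append]

variable {T} in
theorem Transduces.getElem_blockOut {f : ℕ → ℕ} {σ : InfSeq} (h : T.Transduces (blockSeq f) σ)
    (n x : ℕ) (hx : x < (T.blockOut f n).length) :
    σ (T.blockStart f n + x) = (T.blockOut f n)[x] := by
  have h1 : T.outWord T.init (blockWord f (n + 1)) =
      σ.prefixWord (T.blockStart f (n + 1)) := by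
    conv_lhs => rw [blockWord_eq_prefixWord]
    rw [h.1, ← blockWord_eq_prefixWord]
    rfl
  rw [outWord_blockWord_succ] at h1
  have h2 : (T.outWord T.init (blockWord f n) ++ T.blockOut f n)[T.blockStart f n + x]? =
      some (T.blockOut f n)[x] := by
    rw [List.getElem?_append_right (by simp [blockStart])]
    simp [blockStart, hx]
  rw [h1, InfSeq.prefixWord, List.getElem?_map, List.getElem?_range] at h2
  · simpa using h2
  · rw [blockStart_succ]; omega

variable {T} in
theorem Transduces.blockStart_unbounded {f : ℕ → ℕ} {σ : InfSeq}
    (h : T.Transduces (blockSeq f) σ) (x : ℕ) : ∃ n, x ≤ T.blockStart f n := by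
  obtain ⟨n, hn⟩ := h.2 x
  refine ⟨n + 1, hn.trans ?_⟩
  rw [blockStart, blockWord_eq_prefixWord]
  exact T.length_outWord_prefixWord_mono _ _ (lt_length_blockWord_succ f n).le

/-- If each block length is a remainder `ρ n` plus a multiple of a period `d` of the action of the
letter `0`, then the output on block `n` is a word `u n` followed by a power of a word `v n`, both
ultimately periodic in `n` when `ρ` has period `d`. -/
theorem exists_blockOut_eq [Finite Q] (f ρ t : ℕ → ℕ) (a d N : ℕ) (hd : 0 < d)
    (had : ∀ n, a ≤ n → ∀ e, (fun s => T.step s 0)^[n + d * e] = (fun s => T.step s 0)^[n])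
    (hf : ∀ n, N ≤ n → f n = ρ n + d * t n) (hρ : ∀ n, N ≤ n → ρ (n + d) = ρ n)
    (ha : ∀ n, N ≤ n → t n = 0 ∨ a ≤ ρ n) :
    ∃ n₀ e, N ≤ n₀ ∧ 0 < e ∧ ∃ u v : ℕ → List Letter, ∀ n, n₀ ≤ n →
      u (n + d * e) = u n ∧ v (n + d * e) = v n ∧
      T.blockOut f n = u n ++ (List.replicate (t n) (v n)).flatten := by
  set z : Q → Q := fun s => T.step s 0 with hz
  have hρe : ∀ e n, N ≤ n → ρ (n + d * e) = ρ n := fun e n hn => by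
    induction e with
    | zero => simp
    | succ e ih => rw [mul_add, mul_one, ← add_assoc, hρ _ (by omega), ih]
  have hnext : ∀ n, N ≤ n →
      T.blockState f (n + 1) = z^[ρ n] (T.step (T.blockState f n) 1) := fun n hn => by
    rw [blockState_succ, hf n hn]
    rcases ha n hn with h | h
    · simp [h, hz]
    · rw [had _ h]
  have : NeZero d := ⟨hd.ne'⟩
  -- The state in front of a block and the block's index modulo `d` determine the next such pair, so
  -- one repetition yields a period, which is a multiple of `d`.
  obtain ⟨i, j, hne, hij⟩ := Finite.exists_ne_map_eq_of_infinite
    fun n : ℕ => (T.blockState f (N + n), (n : ZMod d))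
  wlog hlt : i < j generalizing i j
  · exact this j i hne.symm hij.symm (by omega)
  obtain ⟨hq, hmod⟩ := Prod.mk.inj hij
  obtain ⟨e, he⟩ : d ∣ j - i :=
    (Nat.modEq_iff_dvd' hlt.le).mp ((ZMod.natCast_eq_natCast_iff _ _ _).mp hmod)
  have hper : ∀ n, N + i ≤ n → T.blockState f (n + d * e) = T.blockState f n := fun n hn => by
    induction n, hn using Nat.le_induction with
    | base => rw [← he, show N + i + (j - i) = N + j by omega, hq]
    | succ n hn ih =>
      rw [show n + 1 + d * e = n + d * e + 1 by omega, hnext _ (by omega), hnext _ (by omega), ih,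
        hρe _ _ (by omega)]
  refine ⟨N + i, e, by omega, Nat.pos_of_ne_zero fun h => by subst h; omega,
    fun n => T.outWord (T.blockState f n) (1 :: List.replicate (ρ n) 0),
    fun n => T.outWord (z^[ρ n] (T.step (T.blockState f n) 1)) (List.replicate d 0),
    fun n hn => ⟨?_, ?_, ?_⟩⟩
  · beta_reduce
    rw [hper n hn, hρe _ _ (by omega)]
  · beta_reduce
    rw [hper n hn, hρe _ _ (by omega)]
  · rw [blockOut, hf n (by omega), List.replicate_add, ← List.cons_append, outWord_append,
      run_cons, run_zeros, ← hz]
    congr 1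
    have hloop : ∀ q : Q, z^[d] q = q → ∀ k, T.outWord q (List.replicate (d * k) 0) =
        (List.replicate k (T.outWord q (List.replicate d 0))).flatten := fun q hq k => by
      induction k with
      | zero => rfl
      | succ k ih =>
        rw [mul_add, mul_one, add_comm, List.replicate_add, outWord_append, run_zeros, ← hz, hq, ih]
        rfl
    rcases ha n (by omega) with h | h
    · rw [h]; rfl
    · refine hloop _ ?_ _
      rw [← Function.iterate_add_apply, add_comm]
      have := had (ρ n) h 1
      rw [mul_one] at this
      rw [this]

/-- If the outputs on the blocks recur, then the output is ultimately periodic. -/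
theorem Transduces.ultimatelyPeriodic {T : FST Q} {f : ℕ → ℕ} {σ : InfSeq}
    (h : T.Transduces (blockSeq f) σ) {n₀ m : ℕ}
    (hm : ∀ n, n₀ ≤ n → T.blockOut f (n + m) = T.blockOut f n) (hpos : 0 < m) :
    UltimatelyPeriodic σ := by
  obtain ⟨D, hD⟩ : ∃ D, T.blockStart f (n₀ + m) = T.blockStart f n₀ + D := by
    refine Nat.exists_eq_add_of_le ?_
    refine (monotone_nat_of_le_succ (f := T.blockStart f) fun n => ?_) (by omega)
    rw [blockStart_succ]; omega
  have hmono : Monotone (T.blockStart f) := monotone_nat_of_le_succ fun n => by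
    rw [blockStart_succ]; omega
  have hstart : ∀ n, n₀ ≤ n → T.blockStart f (n + m) = T.blockStart f n + D := fun n hn => by
    induction n, hn using Nat.le_induction with
    | base => exact hD
    | succ n hn ih =>
      rw [show n + 1 + m = n + m + 1 by omega, blockStart_succ, blockStart_succ, ih, hm n hn]
      omega
  -- If `m` blocks produced no output, the total output would be bounded.
  have hDpos : 0 < D := by
    by_contra hcon
    have hall : ∀ i, T.blockStart f (n₀ + m * i) = T.blockStart f n₀ := fun i => by
      induction i with
      | zero => simp
      | succ i ih => rw [mul_add, mul_one, ← add_assoc, hstart _ (by omega), ih]; omega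
    obtain ⟨k, hk⟩ := h.blockStart_unbounded (T.blockStart f n₀ + 1)
    have h1 := hmono (show k ≤ n₀ + m * k from
      le_add_of_le_right (Nat.le_mul_of_pos_left k hpos))
    have h2 := hall k
    omega
  have hfind : ∀ j x, x < T.blockStart f (n₀ + j) → T.blockStart f n₀ ≤ x → σ (x + D) = σ x := by
    intro j
    induction j with
    | zero => intro x h1 h2; simp at h1; omega
    | succ j ih =>
      intro x h1 h2
      rcases lt_or_ge x (T.blockStart f (n₀ + j)) with h3 | h3
      · exact ih x h3 h2
      · obtain ⟨y, rfl⟩ := Nat.exists_eq_add_of_le h3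
        rw [← add_assoc, blockStart_succ] at h1
        have e1 := h.getElem_blockOut (n₀ + j) y (by omega)
        have e2 := h.getElem_blockOut (n₀ + j + m) y (by rw [hm _ (by omega)]; omega)
        rw [hstart _ (by omega)] at e2
        rw [e1, add_right_comm, e2]
        simp only [hm (n₀ + j) (by omega)]
  refine ⟨T.blockStart f n₀, D, hDpos, fun x hx => ?_⟩
  obtain ⟨k, hk⟩ := h.blockStart_unbounded (x + 1)
  exact hfind k x (lt_of_lt_of_le hk (hmono (by omega))) hx

end FST

/-! ### The spiral of a transduct and the final polynomial -/

/-- A word `u ++ v ^ t` has period `v.length` after `u`. -/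
theorem List.getElem?_append_flatten_replicate {α : Type*} (u v : List α) (t x : ℕ)
    (hx : u.length ≤ x) (hx' : x + v.length < (u ++ (List.replicate t v).flatten).length) :
    (u ++ (List.replicate t v).flatten)[x + v.length]? =
      (u ++ (List.replicate t v).flatten)[x]? := by
  cases t with
  | zero => simp at hx'; omega
  | succ t =>
    have h1 : (List.replicate (t + 1) v).flatten = v ++ (List.replicate t v).flatten := by
      simp [List.replicate_succ]
    have h2 : (List.replicate (t + 1) v).flatten = (List.replicate t v).flatten ++ v := by
      simp [List.replicate_succ']
    rw [List.length_append] at hx'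
    rw [List.getElem?_append_right (by omega), List.getElem?_append_right hx]
    conv_lhs => rw [h1, List.getElem?_append_right (by omega)]
    have h3 := congrArg List.length h1
    rw [List.length_append] at h3
    rw [h2, List.getElem?_append_left (by omega)]
    congr 1
    omega

theorem transducible_of_natDegree_pos (p : Polynomial ℕ) (hp : 0 < p.natDegree) (σ : InfSeq)
    (hσ : Transducible (blockSeq fun n => p.eval n) σ) (hper : ¬ UltimatelyPeriodic σ) :
    ∃ q : Polynomial ℕ, q.natDegree = p.natDegree ∧
      Transducible σ (blockSeq fun n => q.eval n) := by
  obtain ⟨Q, _, T, hT⟩ := hσ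
  set f : ℕ → ℕ := fun n => p.eval n with hf
  obtain ⟨a, d, hd, had⟩ := Function.exists_iterate_add_eq fun s => T.step s 0
  have hle : ∀ n, n ≤ f n := p.le_eval_of_natDegree_pos hp
  -- The remainder is taken in `[a, a + d)`, so that after reading it the state already lies on a
  -- cycle of the letter 0.
  obtain ⟨N, e, hN, he, u, v, huv⟩ := T.exists_blockOut_eq f (fun n => a + (f n - a) % d)
    (fun n => (f n - a) / d) a d a hd had (fun n hn => by
      have := hle n
      have := Nat.mod_add_div (f n - a) d
      omega) (fun n hn => by
      obtain ⟨P, -, hP⟩ := p.exists_increment hp hd one_pos n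
      have h1 := hP 1
      have h2 := hle n
      rw [mul_one, mul_one] at h1
      simp only [hf] at h2 ⊢
      rw [h1, show p.eval n + d * P.eval 1 - a = p.eval n - a + d * P.eval 1 by omega,
        Nat.add_mul_mod_self_left]) (fun n _ => Or.inr (Nat.le_add_right _ _))
  set t : ℕ → ℕ := fun n => (f n - a) / d with ht
  set m := d * e with hm
  have hmpos : 0 < m := Nat.mul_pos hd he
  set len : ℕ → ℕ := fun n => (T.blockOut f n).length with hlen
  have hlen_eq : ∀ n, N ≤ n → len n = (u n).length + t n * (v n).length := fun n hn => by
    simp [hlen, ht, (huv n hn).2.2]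
  have hvi : ∀ i n, N ≤ n → u (n + m * i) = u n ∧ v (n + m * i) = v n := fun i n hn => by
    induction i with
    | zero => simp
    | succ i ih =>
      rw [mul_add, mul_one, ← add_assoc, (huv _ (by omega)).1, (huv _ (by omega)).2.1]
      exact ih
  choose P hPdeg hPeval using p.exists_increment hp hd he
  have hti : ∀ n, N ≤ n → ∀ i, t (n + m * i) = t n + (P n).eval i := fun n hn i => by
    have h1 := hPeval n i
    have h2 := hle n
    simp only [hf] at h2
    simp only [ht, hf]
    rw [h1, show p.eval n + d * (P n).eval i - a = p.eval n - a + d * (P n).eval i by omega,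
      Nat.add_mul_div_left _ _ hd]
  have hleni : ∀ n, N ≤ n → ∀ i, len (n + m * i) = len n + (v n).length * (P n).eval i :=
    fun n hn i => by
      rw [hlen_eq _ (by omega), hlen_eq n hn, (hvi i n hn).1, (hvi i n hn).2, hti n hn]
      ring
  have hreduce : ∀ k n, N ≤ k → k ≤ n → ∃ j, j < m ∧ v n = v (k + j) := fun k n hk hn =>
    ⟨(n - k) % m, Nat.mod_lt _ hmpos, by
      have h1 := (hvi ((n - k) / m) (k + (n - k) % m) (by omega)).2
      rw [← h1]
      congr 1
      have := Nat.mod_add_div (n - k) m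
      omega⟩
  -- If all `v` were empty from `k` on, the block outputs would recur and `σ` would be ultimately
  -- periodic.
  have hexists : ∀ k, N ≤ k → ∃ j, j < m ∧ v (k + j) ≠ [] := fun k hk => by
    by_contra hcon
    push Not at hcon
    refine hper (hT.ultimatelyPeriodic (n₀ := k) (m := m) (fun n hn => ?_) hmpos)
    obtain ⟨j, hj, hjv⟩ := hreduce k n hk hn
    have hv : v n = [] := by rw [hjv, hcon j hj]
    obtain ⟨h1, h2, h3⟩ := huv n (by omega)
    rw [h3, (huv (n + m) (by omega)).2.2, h1, h2, hv]
    simp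
  -- The `max 1` keeps `r` positive when some `v` is empty.
  set r := ∏ j ∈ Finset.range m, max 1 (v (N + j)).length with hr
  have hrpos : 0 < r := Finset.prod_pos fun j _ => by positivity
  have hdvd : ∀ n, N ≤ n → v n ≠ [] → (v n).length ∣ r := fun n hn hv => by
    obtain ⟨j, hj, hjv⟩ := hreduce N n le_rfl hn
    have h1 := Finset.dvd_prod_of_mem (fun j => max 1 (v (N + j)).length)
      (Finset.mem_range.mpr hj)
    have h2 : 1 ≤ (v n).length := List.length_pos_iff.mpr hv
    beta_reduce at h1
    rwa [← hjv, max_eq_right h2] at h1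
  have hget : ∀ n, N ≤ n → ∀ x, x < len n →
      (u n ++ (List.replicate (t n) (v n)).flatten)[x]? = some (σ (T.blockStart f n + x)) :=
    fun n hn x hx => by
      rw [hT.getElem_blockOut n x hx, ← List.getElem?_eq_getElem hx, (huv n hn).2.2]
  -- Beyond this threshold `t n ≥ r`, so a nonempty `v n` fills at least `r` letters of its factor.
  have hspiral : Spiral σ (T.blockStart f) len m r (N + a + d * r) :=
    { pos_m := hmpos
      pos_r := hrpos
      start_succ := T.blockStart_succ f
      unbounded := hT.blockStart_unbounded
      agree := fun n hn x hx => by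
        have h1 := hleni n (by omega) 1
        have h2 := hti n (by omega) 1
        have h3 := hget n (by omega) x hx
        rw [mul_one] at h1 h2
        have h4 := hget (n + m) (by omega) x (by omega)
        have hlt : x < (u n ++ (List.replicate (t n) (v n)).flatten).length := by
          have := hlen_eq n (by omega)
          simp
          omega
        rw [h2, (huv n (by omega)).1, (huv n (by omega)).2.1, List.replicate_add,
          List.flatten_append, ← List.append_assoc, List.getElem?_append_left hlt, h3] at h4
        exact Option.some.inj h4
      growth := fun n hn => by
        have h1 := hleni n (by omega) 1
        rw [mul_one] at h1
        rcases eq_or_ne (v n) [] with hv | hv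
        · left
          simpa [hv] using h1
        · right
          have hrt : r ≤ t n := by
            rw [ht, Nat.le_div_iff_mul_le hd, mul_comm]
            have := hle n
            omega
          have h2 : 1 ≤ (v n).length := List.length_pos_iff.mpr hv
          refine ⟨(v n).length, (P n).eval 1, (u n).length, hdvd n (by omega) hv, h1, ?_, ?_⟩
          · rw [hlen_eq n (by omega)]
            have := Nat.mul_le_mul hrt h2
            omega
          · intro k hk x hx hx'
            have hkn : n ≤ k := by omega
            have huk : u k = u n ∧ v k = v n := by
              rcases hk with rfl | rfl
              · exact ⟨rfl, rfl⟩
              · exact ⟨(huv n (by omega)).1, (huv n (by omega)).2.1⟩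
            have h3 := hget k (by omega) x (by omega)
            have h4 := hget k (by omega) _ hx'
            rw [← huk.2, List.getElem?_append_flatten_replicate _ _ _ _ (by rw [huk.1]; exact hx)
              (by
                have := hlen_eq k (by omega)
                have h5 : (v k).length = (v n).length := by rw [huk.2]
                simp
                omega), h3, huk.2] at h4
            rw [add_assoc]
            exact Option.some.inj h4 }
  obtain ⟨n, hn, hpos, hF⟩ := hspiral.exists_transducible hper
  have hnN : N ≤ n := by omega
  set c := ∑ j ∈ Finset.range m, len (n + j) with hc
  have hcpos : 0 < c :=
    lt_of_lt_of_le hpos (Finset.single_le_sum (f := fun j => len (n + j))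
      (fun _ _ => Nat.zero_le _) (Finset.mem_range.mpr hmpos))
  -- `R` is the growth of the total length of `m` consecutive factors; a single nonempty `v` secures
  -- its degree, as natural coefficients do not cancel.
  set R := ∑ j ∈ Finset.range m, Polynomial.C (v (n + j)).length * P (n + j) with hR
  have hRdeg : R.natDegree = p.natDegree := by
    refine le_antisymm (Polynomial.natDegree_sum_le_of_forall_le _ _ fun j _ => ?_) ?_
    · exact (Polynomial.natDegree_C_mul_le _ _).trans (hPdeg _).le
    · refine Polynomial.le_natDegree_of_ne_zero ?_
      obtain ⟨j, hj, hjv⟩ := hexists n hnN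
      rw [hR, Polynomial.finsetSum_coeff]
      intro h0
      have h1 := Finset.sum_eq_zero_iff.mp h0 j (Finset.mem_range.mpr hj)
      rw [Polynomial.coeff_C_mul, Nat.mul_eq_zero] at h1
      rcases h1 with h1 | h1
      · exact hjv (List.length_eq_zero_iff.mp h1)
      · rw [← hPdeg (n + j)] at h1
        have h2 := Polynomial.leadingCoeff_eq_zero.mp h1
        have h3 := hPdeg (n + j)
        rw [h2, Polynomial.natDegree_zero] at h3
        omega
  -- The gap `c + R.eval i` includes the letter 1 opening the block, hence `c - 1` zeros besides
  -- `R.eval i`; here `c > 0`.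
  refine ⟨R + Polynomial.C (c - 1), by rw [Polynomial.natDegree_add_C, hRdeg], hF _ fun i => ?_⟩
  have hsum : ∀ k l, T.blockStart f (k + l) =
      T.blockStart f k + ∑ j ∈ Finset.range l, len (k + j) := fun k l => by
    induction l with
    | zero => simp
    | succ l ih =>
      rw [← add_assoc, T.blockStart_succ, ih, Finset.sum_range_succ, add_assoc]
  have h1 : ∑ j ∈ Finset.range m, len (n + m * i + j) = c + R.eval i := by
    rw [hc, hR, Polynomial.eval_finsetSum, ← Finset.sum_add_distrib]
    refine Finset.sum_congr rfl fun j _ => ?_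
    rw [add_right_comm, hleni _ (by omega)]
    simp
  rw [mul_add, mul_one, ← add_assoc, hsum, h1, Polynomial.eval_add, Polynomial.eval_C]
  omega

/-- With `t = 0` the whole output on a block is `u n`, which recurs. This excludes constant `p`. -/
theorem ultimatelyPeriodic_of_transducible_const (k : ℕ) (σ : InfSeq)
    (hσ : Transducible (blockSeq fun _ => k) σ) : UltimatelyPeriodic σ := by
  obtain ⟨Q, _, T, hT⟩ := hσ
  obtain ⟨a, d, hd, had⟩ := Function.exists_iterate_add_eq fun s => T.step s 0
  obtain ⟨N, e, -, he, u, v, huv⟩ := T.exists_blockOut_eq (fun _ => k) (fun _ => k) (fun _ => 0)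
    a d 0 hd had (fun _ _ => rfl) (fun _ _ => rfl) (fun _ _ => Or.inl rfl)
  refine hT.ultimatelyPeriodic (n₀ := N) (m := d * e) (fun n hn => ?_) (Nat.mul_pos hd he)
  rw [(huv n hn).2.2, (huv _ (by omega)).2.2, (huv n hn).1]
  rfl

theorem mainTheorem3 (p : Polynomial ℕ) (σ : InfSeq)
    (hσ : Transducible (blockSeq fun n => p.eval n) σ) (hper : ¬ UltimatelyPeriodic σ) :
    ∃ q : Polynomial ℕ, q.degree = p.degree ∧
      Transducible σ (blockSeq fun n => q.eval n) := by
  rcases Nat.eq_zero_or_pos p.natDegree with h0 | hpos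
  · rw [Polynomial.eq_C_of_natDegree_eq_zero h0] at hσ
    simp only [Polynomial.eval_C] at hσ
    exact absurd (ultimatelyPeriodic_of_transducible_const _ σ hσ) hper
  · obtain ⟨q, hq, h⟩ := transducible_of_natDegree_pos p hpos σ hσ hper
    refine ⟨q, ?_, h⟩
    rw [Polynomial.degree_eq_natDegree (Polynomial.ne_zero_of_natDegree_gt hpos),
      Polynomial.degree_eq_natDegree (Polynomial.ne_zero_of_natDegree_gt (hq ▸ hpos)), hq]
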